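/- **Theorem.** Let $\mathfrak R$ be a complete, separated topological associative (unital) ring, let $R$ be an associative ring, and let $\theta\colon R\to\mathfrak R$ be a ring homomorphism with dense image. Assume that $\mathfrak R$ has a countable base of neighborhoods of zero consisting of open two-sided ideals, each of which, viewed as a right ideal, is strongly generated by a finite set of elements lying in $\theta(R)$. Then the forgetful functor $\mathfrak R\text{-contra}\to R\text{-mod}$ from left $\mathfrak R$-contramodules to left $R$-modules is fully faithful. Here the following terminology is used. A family $(r_x)_{x\in X}$ of elements of $\mathfrak R$ *converges to zero* if every neighborhood of zero contains all but finitely many of the $r_x$. A finite set of elements $s_1,\dots,s_m$ of a right ideal $\mathfrak J\subset\mathfrak R$ *strongly generates* $\mathfrak J$ if for every family $(r_x)_{x\in X}$ of elements of $\mathfrak J$ converging to zero in $\mathfrak R$ there are families $(r_{j,x})_{x\in X}$ in $\mathfrak R$, $j=1,\dots,m$, each converging to zero, such that $r_x=\sum_{j=1}^m s_j r_{j,x}$ for all $x\in X$. For a set $X$, let $\mathfrak R[[X]]$ be the set of formal linear combinations $\sum_{x\in X}r_x x$ whose coefficients $r_x\in\mathfrak R$ converge to zero. Then $X\mapsto\mathfrak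 R[[X]]$ is a monad on the category of sets: a map $f\colon X\to Y$ sends $\sum_x r_x x$ to $\sum_{y}\bigl(\sum_{f(x)=y}r_x\bigr)y$, the unit sends $x$ to $1\cdot x$, and the multiplication $\mathfrak R[[\mathfrak R[[X]]]]\to\mathfrak R[[X]]$ opens the parentheses, the infinite sums of coefficients being the limits of finite partial sums in $\mathfrak R$. *Left $\mathfrak R$-contramodules* are the modules (Eilenberg–Moore algebras) over this monad. The *forgetful functor* equips a contramodule $C$ with structure map $\pi\colon\mathfrak R[[C]]\to C$ with the left $R$-module structure $c+d=\pi(1\cdot c+1\cdot d)$, $r c=\pi(\theta(r)\cdot c)$, and leaves the underlying maps of morphisms unchanged. -/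

import Mathlib

open CategoryTheory Filter Topology

universe u v w

noncomputable section

/-! Throughout, `K` is a complete, separated topological associative ring in which the open
right ideals form a base of neighborhoods of zero.  The last condition is spelled
`IsLinearTopology Kᵐᵒᵖ K` (a right ideal is a submodule over the opposite ring). -/

/-- The set `K[[X]]` of all infinite formal linear combinations `∑ r_x x` of elements of `X`
with the family of coefficients `r_x` in `K` converging to zero: every neighborhood of zero
contains all but finitely many of the `r_x`. -/
structure FormalComb (K : Type u) [Ring K] [TopologicalSpace K] (X : Type w) :
    Type (max u w) where
  /-- The family of coefficients. -/
  coeff : X → K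
  tendsto : Tendsto coeff cofinite (𝓝 0)

namespace FormalComb

section Algebraic

variable {K : Type u} [Ring K] [TopologicalSpace K] [IsTopologicalRing K] {X : Type w}

instance : CoeFun (FormalComb K X) (fun _ => X → K) := ⟨coeff⟩

@[ext]
theorem ext {r t : FormalComb K X} (h : ∀ x, r x = t x) : r = t := by
  cases r
  cases t
  congr 1
  exact funext h

instance : Zero (FormalComb K X) := ⟨⟨fun _ => 0, tendsto_const_nhds⟩⟩

instance : Add (FormalComb K X) :=
  ⟨fun r t => ⟨fun x => r x + t x, by simpa using r.tendsto.add t.tendsto⟩⟩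

instance : Neg (FormalComb K X) :=
  ⟨fun r => ⟨fun x => - r x, by simpa using r.tendsto.neg⟩⟩

instance : SMul K (FormalComb K X) :=
  ⟨fun k r => ⟨fun x => k * r x, by simpa using r.tendsto.const_mul k⟩⟩

@[simp] theorem zero_apply (x : X) : (0 : FormalComb K X) x = 0 := rfl
@[simp] theorem add_apply (r t : FormalComb K X) (x : X) : (r + t) x = r x + t x := rfl
@[simp] theorem neg_apply (r : FormalComb K X) (x : X) : (-r) x = - r x := rfl
@[simp] theorem smul_apply (k : K) (r : FormalComb K X) (x : X) : (k • r) x = k * r x := rfl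

open Classical in
/-- The element `x` of `X` as a formal linear combination: coefficient `1` at `x`,
and `0` elsewhere. -/
def pure (K : Type u) [Ring K] [TopologicalSpace K] {X : Type w} (x : X) : FormalComb K X :=
  ⟨fun y => if y = x then 1 else 0, by
    refine tendsto_const_nhds.congr' ?_
    have : ({x}ᶜ : Set X) ∈ cofinite := (Set.finite_singleton x).compl_mem_cofinite
    filter_upwards [this] with y hy
    rw [if_neg (by simpa using hy)]⟩

end Algebraic

section Infinite

variable {K : Type u} [Ring K] [UniformSpace K] [IsUniformAddGroup K] [IsTopologicalRing K]
  [IsLinearTopology Kᵐᵒᵖ K]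

theorem hasBasis_open : (𝓝 (0 : K)).HasBasis
    (fun J : Submodule Kᵐᵒᵖ K => IsOpen (J : Set K)) (fun J => (J : Set K)) :=
  IsLinearTopology.hasBasis_open_submodule Kᵐᵒᵖ

theorem mul_mem_right {J : Submodule Kᵐᵒᵖ K} {a : K} (ha : a ∈ J) (b : K) : a * b ∈ J := by
  simpa using J.smul_mem (MulOpposite.op b) ha

theorem tendsto_zero_iff {X : Type w} {r : X → K} : Tendsto r cofinite (𝓝 0) ↔
    ∀ J : Submodule Kᵐᵒᵖ K, IsOpen (J : Set K) → {x | r x ∉ J}.Finite := by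
  rw [hasBasis_open.tendsto_right_iff]
  rfl

theorem tsum_mem {X : Type w} {r : X → K} {J : Submodule Kᵐᵒᵖ K} (hJ : IsOpen (J : Set K))
    (h : ∀ x, r x ∈ J) : ∑' x, r x ∈ J := by
  by_cases hs : Summable r
  · have hc : IsClosed (J : Set K) := AddSubgroup.isClosed_of_isOpen J.toAddSubgroup hJ
    exact hc.mem_of_tendsto hs.hasSum (Eventually.of_forall fun s => J.sum_mem fun x _ => h x)
  · rw [tsum_eq_zero_of_not_summable hs]; exact J.zero_mem

theorem summable [CompleteSpace K] {X : Type w} {r : X → K} (hr : Tendsto r cofinite (𝓝 0)) :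
    Summable r := by
  have : NonarchimedeanAddGroup K :=
    { is_nonarchimedean := fun U hU => by
        obtain ⟨J, hJ, hJU⟩ := hasBasis_open.mem_iff.1 hU
        exact ⟨⟨J.toAddSubgroup, hJ⟩, hJU⟩ }
  exact NonarchimedeanAddGroup.summable_of_tendsto_cofinite_zero hr

theorem tendsto_double {X : Type v} {Y : Type w} (r : FormalComb K X) (t : X → FormalComb K Y) :
    Tendsto (fun p : X × Y => r p.1 * t p.1 p.2) cofinite (𝓝 0) := by
  rw [tendsto_zero_iff]
  intro J hJ
  have hF := tendsto_zero_iff.1 r.2 J hJ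
  have hG : ∀ x, {y | r x * t x y ∉ J}.Finite := fun x =>
    tendsto_zero_iff.1 (r x • t x).2 J hJ
  refine (hF.biUnion fun x _ => (hG x).image fun y => (x, y)).subset ?_
  rintro ⟨x, y⟩ hxy
  simp only [Set.mem_iUnion, Set.mem_image]
  exact ⟨x, fun hx => hxy (mul_mem_right hx _), y, hxy, rfl⟩

theorem tendsto_mul_right {X : Type w} {r : X → K} (hr : Tendsto r cofinite (𝓝 0)) (t : X → K) :
    Tendsto (fun x => r x * t x) cofinite (𝓝 0) :=
  IsLinearTopology.tendsto_mul_zero_of_left r t hr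

/-- The map `K[[f]] : K[[X]] → K[[Y]]` induced by a map of sets `f : X → Y`; its coefficient at
`y` is the (unconditionally convergent) sum of the coefficients over the fiber of `f`. -/
def map {X : Type v} {Y : Type w} (f : X → Y) (r : FormalComb K X) : FormalComb K Y :=
  ⟨fun y => ∑' x : {x : X // f x = y}, r x.1, by
    rw [tendsto_zero_iff]
    intro J hJ
    refine ((tendsto_zero_iff.1 r.2 J hJ).image f).subset ?_
    intro y hy
    by_contra hcon
    refine hy (tsum_mem hJ ?_)
    rintro ⟨x, rfl⟩
    by_contra hx
    exact hcon ⟨x, hx, rfl⟩⟩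

/-- The sum `∑_x r_x t_x` of an `X`-indexed family `t_x` in `K[[Y]]` with the coefficients `r_x`,
computed coefficientwise. -/
def bind {X : Type v} {Y : Type w} (r : FormalComb K X) (t : X → FormalComb K Y) :
    FormalComb K Y :=
  ⟨fun y => ∑' x, r x * t x y, by
    rw [tendsto_zero_iff]
    intro J hJ
    refine ((tendsto_zero_iff.1 (tendsto_double r t) J hJ).image Prod.snd).subset ?_
    intro y hy
    by_contra hcon
    refine hy (tsum_mem hJ fun x => ?_)
    by_contra hx
    exact hcon ⟨(x, y), hx, rfl⟩⟩

/-- The map `K[[K[[X]]]] → K[[X]]` opening the parentheses: the coefficient of `∑_t r_t t`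
at `x` is `∑_t r_t t_x`. -/
def join {X : Type w} (r : FormalComb K (FormalComb K X)) : FormalComb K X :=
  ⟨fun x => ∑' t : FormalComb K X, r t * t x, (bind r id).2⟩

theorem join_eq_bind {X : Type w} (r : FormalComb K (FormalComb K X)) : join r = bind r id := rfl

theorem map_eq_bind {X : Type v} {Y : Type w} (f : X → Y) (r : FormalComb K X) :
    map f r = bind r (fun x => pure K (f x)) := by
  classical
  ext y
  change ∑' x : {x : X // f x = y}, r x.1 = ∑' x, r x * (if y = f x then 1 else 0)
  refine (tsum_subtype {x : X | f x = y} (fun x => r x)).trans ?_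
  refine tsum_congr fun x => ?_
  by_cases h : f x = y
  · rw [Set.indicator_of_mem (by exact h), if_pos h.symm, mul_one]
  · rw [Set.indicator_of_notMem (by exact h), if_neg (Ne.symm h), mul_zero]

variable [T2Space K]

theorem pure_bind {X : Type v} {Y : Type w} (x : X) (t : X → FormalComb K Y) :
    bind (pure K x) t = t x := by
  classical
  ext y
  change ∑' x', (if x' = x then 1 else 0) * t x' y = t x y
  rw [tsum_eq_single x (fun x' hx' => by rw [if_neg hx', zero_mul]), if_pos rfl, one_mul]

theorem bind_pure {X : Type w} (r : FormalComb K X) : bind r (pure K) = r := by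
  classical
  ext y
  change ∑' x, r x * (if y = x then 1 else 0) = r y
  rw [tsum_eq_single y (fun x hx => by rw [if_neg (Ne.symm hx), mul_zero]), if_pos rfl, mul_one]

variable [CompleteSpace K]

theorem bind_assoc {X : Type*} {Y : Type*} {Z : Type*} (r : FormalComb K X)
    (t : X → FormalComb K Y) (s : Y → FormalComb K Z) :
    bind (bind r t) s = bind r (fun x => bind (t x) s) := by
  ext z
  change ∑' y, (∑' x, r x * t x y) * s y z = ∑' x, r x * ∑' y, t x y * s y z
  have h2 := tendsto_double r t
  have hsum : Summable fun p : X × Y => r p.1 * t p.1 p.2 * s p.2 z :=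
    summable (tendsto_mul_right h2 _)
  have hcol : ∀ y, Summable fun x => r x * t x y := fun y =>
    summable (tendsto_mul_right r.2 _)
  have hrow : ∀ x, Summable fun y => t x y * s y z := fun x =>
    summable (tendsto_mul_right (t x).2 _)
  calc ∑' y, (∑' x, r x * t x y) * s y z
      = ∑' y, ∑' x, r x * t x y * s y z :=
        tsum_congr fun y => ((hcol y).tsum_mul_right (s y z)).symm
    _ = ∑' x, ∑' y, r x * t x y * s y z := by
        refine Summable.tsum_comm' (f := fun x y => r x * t x y * s y z) hsum ?_ ?_
        · intro x
          simpa only [mul_assoc] using (hrow x).mul_left (r x)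
        · intro y
          exact (hcol y).mul_right (s y z)
    _ = ∑' x, r x * ∑' y, t x y * s y z :=
        tsum_congr fun x => by
          simp only [mul_assoc]
          exact (hrow x).tsum_mul_left (r x)

theorem bind_add {X : Type v} {Y : Type w} (r r' : FormalComb K X) (t : X → FormalComb K Y) :
    bind (r + r') t = bind r t + bind r' t := by
  ext y
  change ∑' x, (r x + r' x) * t x y = ∑' x, r x * t x y + ∑' x, r' x * t x y
  simp only [add_mul]
  exact (summable (tendsto_mul_right r.2 _)).tsum_add (summable (tendsto_mul_right r'.2 _))

theorem bind_neg {X : Type v} {Y : Type w} (r : FormalComb K X) (t : X → FormalComb K Y) :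
    bind (-r) t = - bind r t := by
  ext y
  change ∑' x, (- r x) * t x y = - ∑' x, r x * t x y
  simp only [neg_mul]
  exact tsum_neg

theorem bind_zero {X : Type v} {Y : Type w} (t : X → FormalComb K Y) :
    bind (0 : FormalComb K X) t = 0 := by
  ext y
  change ∑' x, 0 * t x y = 0
  simp

theorem bind_smul {X : Type v} {Y : Type w} (k : K) (r : FormalComb K X)
    (t : X → FormalComb K Y) : bind (k • r) t = k • bind r t := by
  ext y
  change ∑' x, k * r x * t x y = k * ∑' x, r x * t x y
  simp only [mul_assoc]
  exact (summable (tendsto_mul_right r.2 _)).tsum_mul_left k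

theorem map_pure {X : Type v} {Y : Type w} (f : X → Y) (x : X) :
    map f (pure K x) = pure K (f x) := by
  rw [map_eq_bind, pure_bind]

theorem map_id {X : Type w} (r : FormalComb K X) : map (fun x => x) r = r := by
  rw [map_eq_bind, bind_pure]

theorem map_map {X Y Z : Type*} (f : X → Y) (g : Y → Z) (r : FormalComb K X) :
    map g (map f r) = map (fun x => g (f x)) r := by
  simp only [map_eq_bind, bind_assoc, pure_bind]

theorem join_pure {X : Type w} (r : FormalComb K X) : join (pure K r) = r := by
  rw [join_eq_bind, pure_bind]; rfl

theorem join_map_pure {X : Type w} (r : FormalComb K X) : join (map (pure K) r) = r := by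
  rw [join_eq_bind, map_eq_bind, bind_assoc]
  simp only [pure_bind, id]
  exact bind_pure r

theorem join_map_map {X : Type v} {Y : Type w} (f : X → Y) (r : FormalComb K (FormalComb K X)) :
    join (map (map f) r) = map f (join r) := by
  simp only [join_eq_bind, map_eq_bind, bind_assoc, pure_bind, id]

theorem join_map_join {X : Type w} (r : FormalComb K (FormalComb K (FormalComb K X))) :
    join (map join r) = join (join r) := by
  simp only [join_eq_bind, map_eq_bind, bind_assoc, pure_bind, id]

end Infinite

end FormalComb

section Contramodules

variable (K : Type u) [Ring K] [UniformSpace K] [IsUniformAddGroup K] [IsTopologicalRing K]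
  [CompleteSpace K] [T2Space K] [IsLinearTopology Kᵐᵒᵖ K]

/-- The monad `X ↦ K[[X]]` on the category of sets. -/
def contraMonad : Monad (Type (max u v)) where
  obj X := FormalComb K X
  map f := ↾(FormalComb.map (K := K) f)
  map_id X := by
    refine ConcreteCategory.hom_ext _ _ fun r => ?_
    exact FormalComb.map_id r
  map_comp f g := by
    refine ConcreteCategory.hom_ext _ _ fun r => ?_
    exact (FormalComb.map_map f g r).symm
  η :=
    { app := fun X => ↾(fun x : X => FormalComb.pure K x)
      naturality := fun X Y f => by
        refine ConcreteCategory.hom_ext _ _ fun x => ?_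
        exact (FormalComb.map_pure f x).symm }
  μ :=
    { app := fun X => ↾(fun r : FormalComb K (FormalComb K X) => FormalComb.join r)
      naturality := fun X Y f => by
        refine ConcreteCategory.hom_ext _ _ fun r => ?_
        exact FormalComb.join_map_map f r }
  assoc X := by
    refine ConcreteCategory.hom_ext _ _ fun r => ?_
    exact FormalComb.join_map_join r
  left_unit X := by
    refine ConcreteCategory.hom_ext _ _ fun r => ?_
    exact FormalComb.join_pure r
  right_unit X := by
    refine ConcreteCategory.hom_ext _ _ fun r => ?_
    exact FormalComb.join_map_pure r

/-- The category of left `K`-contramodules: modules (algebras) over the monad `X ↦ K[[X]]`. -/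
abbrev Contramodule : Type (max u v + 1) := (contraMonad.{u, v} K).Algebra

end Contramodules

namespace Contramodule

variable {K : Type u} [Ring K] [UniformSpace K] [IsUniformAddGroup K] [IsTopologicalRing K]
  [CompleteSpace K] [T2Space K] [IsLinearTopology Kᵐᵒᵖ K]

/-- The underlying set of a contramodule. -/
def Carrier (C : Contramodule.{u, v} K) : Type (max u v) := C.A

/-- The contraaction map `π : K[[C]] → C`. -/
def contraaction (C : Contramodule.{u, v} K) (r : FormalComb K C.Carrier) : C.Carrier :=
  C.a r

variable (C : Contramodule.{u, v} K)

theorem contraaction_pure (c : C.Carrier) : C.contraaction (FormalComb.pure K c) = c :=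
  ConcreteCategory.congr_hom C.unit c

theorem contraaction_join (r : FormalComb K (FormalComb K C.Carrier)) :
    C.contraaction (FormalComb.join r) = C.contraaction (FormalComb.map C.contraaction r) :=
  ConcreteCategory.congr_hom C.assoc r

/-! The operations of a `K`-module on a contramodule are the finite instances of
the contraaction: `c + d = π(1·c + 1·d)`, `0 = π(0)`, `-c = π((-1)·c)`, `k c = π(k·c)`. -/

instance : Zero C.Carrier := ⟨C.contraaction 0⟩

instance : Add C.Carrier :=
  ⟨fun c d => C.contraaction (FormalComb.pure K c + FormalComb.pure K d)⟩

instance : Neg C.Carrier := ⟨fun c => C.contraaction (-FormalComb.pure K c)⟩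

instance : SMul K C.Carrier := ⟨fun k c => C.contraaction (k • FormalComb.pure K c)⟩

theorem contraaction_zero : C.contraaction 0 = 0 := rfl

theorem contraaction_add (r t : FormalComb K C.Carrier) :
    C.contraaction (r + t) = C.contraaction r + C.contraaction t := by
  have h := C.contraaction_join (FormalComb.pure K r + FormalComb.pure K t)
  simp only [FormalComb.join_eq_bind, FormalComb.map_eq_bind, FormalComb.bind_add,
    FormalComb.pure_bind, id] at h
  exact h

theorem contraaction_neg (r : FormalComb K C.Carrier) :
    C.contraaction (-r) = - C.contraaction r := by
  have h := C.contraaction_join (-FormalComb.pure K r)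
  simp only [FormalComb.join_eq_bind, FormalComb.map_eq_bind, FormalComb.bind_neg,
    FormalComb.pure_bind, id] at h
  exact h

theorem contraaction_smul (k : K) (r : FormalComb K C.Carrier) :
    C.contraaction (k • r) = k • C.contraaction r := by
  have h := C.contraaction_join (k • FormalComb.pure K r)
  simp only [FormalComb.join_eq_bind, FormalComb.map_eq_bind, FormalComb.bind_smul,
    FormalComb.pure_bind, id] at h
  exact h

theorem exists_rep (c : C.Carrier) : ∃ r : FormalComb K C.Carrier, C.contraaction r = c :=
  ⟨_, C.contraaction_pure c⟩

instance : AddCommGroup C.Carrier where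
  add_assoc a b c := by
    obtain ⟨a, rfl⟩ := C.exists_rep a
    obtain ⟨b, rfl⟩ := C.exists_rep b
    obtain ⟨c, rfl⟩ := C.exists_rep c
    simp only [← contraaction_add]
    congr 1
    ext x
    simp [add_assoc]
  zero_add a := by
    obtain ⟨a, rfl⟩ := C.exists_rep a
    rw [← contraaction_zero, ← contraaction_add]
    congr 1
    ext x
    simp
  add_zero a := by
    obtain ⟨a, rfl⟩ := C.exists_rep a
    rw [← contraaction_zero, ← contraaction_add]
    congr 1
    ext x
    simp
  add_comm a b := by
    obtain ⟨a, rfl⟩ := C.exists_rep a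
    obtain ⟨b, rfl⟩ := C.exists_rep b
    simp only [← contraaction_add]
    congr 1
    ext x
    simp [add_comm]
  neg_add_cancel a := by
    obtain ⟨a, rfl⟩ := C.exists_rep a
    rw [← contraaction_neg, ← contraaction_add, ← contraaction_zero]
    congr 1
    ext x
    simp
  nsmul := nsmulRec
  zsmul := zsmulRec

instance : Module K C.Carrier where
  one_smul a := by
    obtain ⟨a, rfl⟩ := C.exists_rep a
    rw [← contraaction_smul]
    congr 1
    ext x
    simp
  mul_smul k l a := by
    obtain ⟨a, rfl⟩ := C.exists_rep a
    simp only [← contraaction_smul]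
    congr 1
    ext x
    simp [mul_assoc]
  smul_zero k := by
    rw [← contraaction_zero, ← contraaction_smul]
    congr 1
    ext x
    simp
  smul_add k a b := by
    obtain ⟨a, rfl⟩ := C.exists_rep a
    obtain ⟨b, rfl⟩ := C.exists_rep b
    simp only [← contraaction_smul, ← contraaction_add]
    congr 1
    ext x
    simp [mul_add]
  add_smul k l a := by
    obtain ⟨a, rfl⟩ := C.exists_rep a
    simp only [← contraaction_smul, ← contraaction_add]
    congr 1
    ext x
    simp [add_mul]
  zero_smul a := by
    obtain ⟨a, rfl⟩ := C.exists_rep a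
    rw [← contraaction_zero, ← contraaction_smul]
    congr 1
    ext x
    simp

variable {C}
variable {D : Contramodule.{u, v} K}

/-- The map of underlying sets of a morphism of contramodules. -/
def homFun (f : C ⟶ D) : C.Carrier → D.Carrier := fun c => f.f c

theorem homFun_contraaction (f : C ⟶ D) (r : FormalComb K C.Carrier) :
    homFun f (C.contraaction r) = D.contraaction (FormalComb.map (homFun f) r) :=
  (ConcreteCategory.congr_hom f.h r).symm

/-- A morphism of contramodules is a morphism of the underlying modules. -/
def homLinear (f : C ⟶ D) : C.Carrier →ₗ[K] D.Carrier where
  toFun := homFun f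
  map_add' c d := by
    change homFun f (C.contraaction _) = D.contraaction _
    rw [homFun_contraaction, FormalComb.map_eq_bind, FormalComb.bind_add, FormalComb.pure_bind,
      FormalComb.pure_bind]
  map_smul' k c := by
    change homFun f (C.contraaction _) = D.contraaction _
    rw [homFun_contraaction, FormalComb.map_eq_bind, FormalComb.bind_smul, FormalComb.pure_bind]
    rfl

variable (K) in
/-- The forgetful functor from left `K`-contramodules to left `K`-modules. -/
def toModule : Contramodule.{u, v} K ⥤ ModuleCat.{max u v} K where
  obj C := ModuleCat.of K C.Carrier
  map f := ModuleCat.ofHom (homLinear f)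

/-- The forgetful functor from left `K`-contramodules to left `R`-modules defined by a ring
homomorphism `θ : R → K`: an element `r` acts on a contramodule by `c ↦ π(θ(r)·c)`. -/
def forgetful {R : Type w} [Ring R] (θ : R →+* K) :
    Contramodule.{u, v} K ⥤ ModuleCat.{max u v} R :=
  toModule K ⋙ ModuleCat.restrictScalars θ

end Contramodule

/-- A two-sided ideal viewed as a right ideal. -/
def TwoSidedIdeal.asRightIdeal {K : Type u} [Ring K] (I : TwoSidedIdeal K) :
    Submodule Kᵐᵒᵖ K where
  carrier := I
  add_mem' := I.add_mem
  zero_mem' := I.zero_mem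
  smul_mem' k x hx := I.mul_mem_right x k.unop hx

/-- The finite family `s₁, …, sₘ` of elements of the right ideal `J` strongly generates `J`: every
family `r_x` in `J` converging to zero in `K` can be written as `r_x = ∑ⱼ sⱼ r_{j,x}` for some
families `r_{j,x}` in `K` (`j = 1, …, m`), each converging to zero.

In a separated ring a family converging to zero takes any nonzero value finitely many times, so
its support is finite or has at most the cardinality of `K`; as one can discard the indices with
`r_x = 0`, no generality is lost by taking the index sets in the universe of `K`. -/
def StronglyGenerates {K : Type u} [Ring K] [TopologicalSpace K] (J : Submodule Kᵐᵒᵖ K)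
    {m : ℕ} (s : Fin m → K) : Prop :=
  (∀ j, s j ∈ J) ∧
  ∀ (X : Type u) (r : X → K), (∀ x, r x ∈ J) → Tendsto r cofinite (𝓝 0) →
    ∃ t : Fin m → X → K, (∀ j, Tendsto (t j) cofinite (𝓝 0)) ∧ ∀ x, r x = ∑ j, s j * t j x

end

/-! A morphism of contramodules is automatically linear, and the content is that an `R`-linear map
`f : C → D` preserves infinite sums `∑ r_c c`.  Both `∑ r_c c ↦ f (∑ r_c c)` and
`∑ r_c c ↦ ∑ r_c f(c)` are `R`-linear maps `K[[C]] → D` which agree on the generators `c`, so it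
suffices that an `R`-linear map `g : K[[X]] → D` killing the generators is zero.

Fix an ideal `I` from the base, strongly generated by `s₁, …, sₘ ∈ θ(R)`.  By density of `θ(R)`, any
`r ∈ K[[X]]` can be changed by a finite combination of generators over `R` so that all its
coefficients lie in `I`; it then equals `∑ sⱼ tⱼ`, and so `g r = ∑ sⱼ g(tⱼ)`.  Thus every value of
`g` is a combination of values of `g` with coefficients in `I`, for every `I` in the base, and a
Nakayama-type argument applies: substituting such expressions into each other for a sequence of
ideals `I₀, I₁, …` converging to zero, one gets `z₀ = g r`, `z₁, z₂, …`, all of value `g r`, such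
that the sums `∑_{n ≥ 0} zₙ` and `∑_{n ≥ 1} zₙ` converge to the same element of `D`. -/

namespace FormalComb

section Coeff

variable {K : Type u} [Ring K] [TopologicalSpace K] {X : Type w}

open Classical in
theorem pure_apply (x y : X) : pure K x y = if y = x then 1 else 0 := rfl

/-- The extension by zero of a formal combination of elements of `Y` along an injective map
`Y → X`.  Unlike `FormalComb.map`, it does not need the topology of `K` to be linear. -/
noncomputable def extend {Y : Type v} (i : Y → X) (hi : Function.Injective i) (r : FormalComb K Y) :
    FormalComb K X :=
  ⟨Function.extend i r 0, fun U hU => ((r.tendsto hU).image i).subset fun x hx => by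
    by_cases hxi : ∃ y, i y = x
    · obtain ⟨y, rfl⟩ := hxi
      exact ⟨y, fun hy => hx (by simpa only [Set.mem_preimage, hi.extend_apply] using hy), rfl⟩
    · refine absurd ?_ hx
      simpa only [Set.mem_preimage, Function.extend_apply' _ _ _ hxi, Pi.zero_apply] using
        mem_of_mem_nhds hU⟩

theorem small_support [T1Space K] (r : FormalComb K X) : Small.{u} (Function.support r) := by
  have hfiber (k : {k : K // k ≠ 0}) : Small.{u} (r ⁻¹' {k.1}) := by
    have hfin : (r ⁻¹' {k.1}).Finite :=
      (r.tendsto (isOpen_ne.mem_nhds k.2.symm)).subset fun _ hx => not_not_intro hx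
    have := hfin.countable.to_subtype
    infer_instance
  have hcover : Function.support r ⊆ ⋃ k : {k : K // k ≠ 0}, r ⁻¹' {k.1} := fun x hx =>
    Set.mem_iUnion.2 ⟨⟨r x, hx⟩, rfl⟩
  exact small_subset hcover

/-- The formal combination `∑_{i,x} z_{i,x} (i, x)` given by a family `z_i ∈ K[[X]]` that converges
to zero uniformly in the coefficients. -/
def uncurry {ι : Type v} (z : ι → FormalComb K X)
    (hz : Tendsto (fun i => Set.range (z i)) cofinite (𝓝 0).smallSets) : FormalComb K (ι × X) :=
  ⟨fun p => z p.1 p.2, fun U hU => by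
    have hι : {i | ¬ Set.range (z i) ⊆ U}.Finite := tendsto_smallSets_iff.1 hz U hU
    refine (hι.biUnion fun i _ => ((z i).tendsto hU).image (Prod.mk i)).subset ?_
    rintro ⟨i, x⟩ hx
    exact Set.mem_biUnion (x := i) (fun hi => hx (hi ⟨x, rfl⟩)) ⟨x, hx, rfl⟩⟩

end Coeff

section Module

variable {K : Type u} [Ring K] [TopologicalSpace K] [IsTopologicalRing K] {X : Type w}

instance : AddCommGroup (FormalComb K X) where
  add_assoc r s t := by ext; exact add_assoc _ _ _
  zero_add r := by ext; exact zero_add _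
  add_zero r := by ext; exact add_zero _
  add_comm r s := by ext; exact add_comm _ _
  neg_add_cancel r := by ext; exact neg_add_cancel _
  nsmul := nsmulRec
  zsmul := zsmulRec

instance : Module K (FormalComb K X) where
  one_smul r := by ext; exact one_mul _
  mul_smul a b r := by ext; exact mul_assoc _ _ _
  smul_zero a := by ext; exact mul_zero _
  smul_add a r s := by ext; exact mul_add _ _ _
  add_smul a b r := by ext; exact add_mul _ _ _
  zero_smul r := by ext; exact zero_mul _

theorem sub_apply (r t : FormalComb K X) (x : X) : (r - t) x = r x - t x := by
  rw [sub_eq_add_neg, add_apply, neg_apply, sub_eq_add_neg]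

theorem sum_apply {ι : Type*} (s : Finset ι) (r : ι → FormalComb K X) (x : X) :
    (∑ i ∈ s, r i) x = ∑ i ∈ s, r i x :=
  map_sum (AddMonoidHom.mk' (fun r : FormalComb K X => r x) fun r t => add_apply r t x) r s

theorem exists_mem_span_range_pure_forall_sub_mem {S : Subring K} (hS : Dense (S : Set K))
    {U : Set K} (hU : U ∈ 𝓝 0) (r : FormalComb K X) :
    ∃ p ∈ Submodule.span S (Set.range (pure K : X → FormalComb K X)), ∀ x, (r - p) x ∈ U := by
  classical
  have hfin : {x | r x ∉ U}.Finite := r.tendsto hU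
  have happrox (x : X) : ∃ a : S, r x - a ∈ U := by
    have hnhds : {a | r x - a ∈ U} ∈ 𝓝 (r x) :=
      (continuous_const.sub continuous_id).continuousAt (by simpa using hU)
    obtain ⟨a, haS, ha⟩ := hS.inter_nhds_nonempty hnhds
    exact ⟨⟨a, haS⟩, ha⟩
  choose a ha using happrox
  have hcoeff (x : X) : (∑ y ∈ hfin.toFinset, a y • pure K y) x =
      if r x ∈ U then 0 else (a x : K) := by
    simp [sum_apply, Subring.smul_def, pure_apply]
  refine ⟨∑ y ∈ hfin.toFinset, a y • pure K y, Submodule.sum_mem _ fun y _ =>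
    Submodule.smul_mem _ _ (Submodule.subset_span ⟨y, rfl⟩), fun x => ?_⟩
  rw [sub_apply, hcoeff]
  split_ifs with hx
  · simpa using hx
  · exact ha x

end Module

section Bind

variable {K : Type u} [Ring K] [UniformSpace K] [IsUniformAddGroup K] [IsTopologicalRing K]
  [IsLinearTopology Kᵐᵒᵖ K] {ι X Y : Type*}

theorem summable_apply_of_tendsto_range [CompleteSpace K] (z : ι → FormalComb K X)
    (hz : Tendsto (fun i => Set.range (z i)) cofinite (𝓝 0).smallSets) (x : X) :
    Summable fun i => z i x :=
  summable ((uncurry z hz).tendsto.comp (Prod.mk_left_injective x).tendsto_cofinite)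

theorem bind_uncurry_apply [CompleteSpace K] [T2Space K] (z : ι → FormalComb K X)
    (hz : Tendsto (fun i => Set.range (z i)) cofinite (𝓝 0).smallSets)
    (t : ι × X → FormalComb K Y) (y : Y) :
    bind (uncurry z hz) t y = ∑' i, bind (z i) (fun x => t (i, x)) y :=
  (summable (tendsto_mul_right (uncurry z hz).tendsto fun p => t p y)).tsum_prod

theorem bind_mem_of_forall_mem (I : TwoSidedIdeal K) (hI : IsOpen (I : Set K))
    (r : FormalComb K X) {t : X → FormalComb K Y} (ht : ∀ x y, t x y ∈ I) (y : Y) :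
    bind r t y ∈ I :=
  tsum_mem (J := I.asRightIdeal) hI fun x => I.mul_mem_left _ _ (ht x y)

/-- The formal combinations obtained from the element `x` by substituting `φ 0 x'` for all elements
`x'`, then `φ 1 x'`, and so on: the `n`-th one is the result of the first `n` substitutions. -/
noncomputable def iterBind (φ : ℕ → X → FormalComb K X) (x : X) : ℕ → FormalComb K X
  | 0 => pure K x
  | n + 1 => bind (iterBind φ x n) (φ n)

theorem tendsto_range_iterBind {I : ℕ → TwoSidedIdeal K} (hopen : ∀ n, IsOpen (I n : Set K))
    (hI : Tendsto (fun n => (I n : Set K)) atTop (𝓝 0).smallSets)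
    {φ : ℕ → X → FormalComb K X} (hφ : ∀ n x y, φ n x y ∈ I n) (x : X) :
    Tendsto (fun n => Set.range (iterBind φ x n)) cofinite (𝓝 0).smallSets := by
  rw [Nat.cofinite_eq_atTop, ← tendsto_add_atTop_iff_nat 1]
  refine hI.smallSets_mono (.of_forall fun n => ?_)
  exact Set.range_subset_iff.2 (bind_mem_of_forall_mem (I n) (hopen n) _ (hφ n))

end Bind

end FormalComb

theorem StronglyGenerates.exists_eq_sum_smul {K : Type u} [Ring K] [TopologicalSpace K]
    [IsTopologicalRing K] [T1Space K] {J : Submodule Kᵐᵒᵖ K} {m : ℕ} {s : Fin m → K}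
    (h : StronglyGenerates J s)
    {X : Type w} (r : FormalComb K X) (hr : ∀ x, r x ∈ J) :
    ∃ t : Fin m → FormalComb K X, r = ∑ j, s j • t j := by
  have := r.small_support
  let i : Shrink.{u} (Function.support r) → X :=
    Subtype.val ∘ (equivShrink (Function.support r)).symm
  have hi : Function.Injective i := Subtype.val_injective.comp (equivShrink _).symm.injective
  obtain ⟨t, ht, hrt⟩ := h.2 _ (r ∘ i) (fun y => hr _) (r.tendsto.comp hi.tendsto_cofinite)
  refine ⟨fun j => FormalComb.extend i hi ⟨t j, ht j⟩, FormalComb.ext fun x => ?_⟩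
  rw [FormalComb.sum_apply]
  change r x = ∑ j, s j * Function.extend i (t j) 0 x
  by_cases hx : ∃ y, i y = x
  · obtain ⟨y, rfl⟩ := hx
    simp only [hi.extend_apply]
    exact hrt y
  · have hrx : r x = 0 := by
      by_contra hne
      exact hx ⟨equivShrink _ ⟨x, hne⟩, by simp [i]⟩
    simp [Function.extend_apply' _ _ _ hx, hrx]

namespace Contramodule

variable {K : Type u} [Ring K] [UniformSpace K] [IsUniformAddGroup K] [IsTopologicalRing K]
  [CompleteSpace K] [T2Space K] [IsLinearTopology Kᵐᵒᵖ K]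

section Lift

variable (D : Contramodule.{u, v} K) {X Y : Type*}

/-- The extension `∑ r_x x ↦ ∑ r_x f(x)` of a map `f : X → D` to the free contramodule
`K[[X]]`. -/
noncomputable def lift (f : X → D.Carrier) : FormalComb K X →ₗ[K] D.Carrier where
  toFun r := D.contraaction (FormalComb.map f r)
  map_add' r t := by simp only [FormalComb.map_eq_bind, FormalComb.bind_add, contraaction_add]
  map_smul' a r := by
    simp only [FormalComb.map_eq_bind, FormalComb.bind_smul, contraaction_smul, RingHom.id_apply]

theorem lift_apply (f : X → D.Carrier) (r : FormalComb K X) :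
    D.lift f r = D.contraaction (FormalComb.map f r) := rfl

theorem lift_id_apply (r : FormalComb K D.Carrier) : D.lift id r = D.contraaction r :=
  congrArg D.contraaction (FormalComb.map_id r)

theorem lift_pure (f : X → D.Carrier) (x : X) : D.lift f (FormalComb.pure K x) = f x := by
  rw [lift_apply, FormalComb.map_pure, contraaction_pure]

theorem lift_bind (f : Y → D.Carrier) (r : FormalComb K X) (t : X → FormalComb K Y) :
    D.lift f (r.bind t) = D.lift (fun x => D.lift f (t x)) r := by
  have hjoin : FormalComb.map f (r.bind t) =
      FormalComb.join (FormalComb.map (fun x => FormalComb.map f (t x)) r) := by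
    simp only [FormalComb.join_eq_bind, FormalComb.map_eq_bind, FormalComb.bind_assoc,
      FormalComb.pure_bind, id]
  rw [lift_apply, hjoin, contraaction_join, FormalComb.map_map]
  rfl

theorem eq_zero_of_forall_exists_lift_eq (g : X → D.Carrier) {I : ℕ → TwoSidedIdeal K}
    (hopen : ∀ n, IsOpen (I n : Set K))
    (hI : Tendsto (fun n => (I n : Set K)) atTop (𝓝 0).smallSets)
    (hg : ∀ n x, ∃ r : FormalComb K X, (∀ y, r y ∈ I n) ∧ D.lift g r = g x) (x : X) :
    g x = 0 := by
  choose φ hφ hgφ using hg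
  let z := FormalComb.iterBind φ x
  have hz := FormalComb.tendsto_range_iterBind hopen hI hφ x
  let w := FormalComb.uncurry z hz
  have htelescope : w.bind (fun p => FormalComb.pure K p.2) =
      FormalComb.pure K x + w.bind (fun p => φ p.1 p.2) := by
    ext y
    rw [FormalComb.add_apply, FormalComb.bind_uncurry_apply, FormalComb.bind_uncurry_apply]
    simp only [FormalComb.bind_pure]
    exact (FormalComb.summable_apply_of_tendsto_range z hz y).tsum_eq_zero_add
  have hsame : D.lift g (w.bind fun p => FormalComb.pure K p.2) =
      D.lift g (w.bind fun p => φ p.1 p.2) := by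
    simp only [lift_bind, lift_pure, hgφ]
  rwa [htelescope, map_add, lift_pure, add_eq_right] at hsame

end Lift

section DenseSubring

variable {S : Subring K} {D : Contramodule.{u, v} K}

theorem exists_lift_eq_of_stronglyGenerates {X : Type*} (hS : Dense (S : Set K))
    {I : TwoSidedIdeal K} (hopen : IsOpen (I : Set K)) {m : ℕ} {s : Fin m → S}
    (hs : StronglyGenerates I.asRightIdeal fun j => (s j : K))
    {g : FormalComb K X →ₗ[S] D.Carrier} (hg : ∀ x, g (FormalComb.pure K x) = 0)
    (r : FormalComb K X) :
    ∃ φ : FormalComb K (FormalComb K X), (∀ t, φ t ∈ I) ∧ D.lift g φ = g r := by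
  obtain ⟨p, hp, hrp⟩ :=
    FormalComb.exists_mem_span_range_pure_forall_sub_mem hS (hopen.mem_nhds I.zero_mem) r
  have hgp : g p = 0 :=
    (Submodule.span_le (p := LinearMap.ker g)).2 (Set.range_subset_iff.2 hg) hp
  obtain ⟨t, ht⟩ := hs.exists_eq_sum_smul (r - p) hrp
  refine ⟨∑ j, (s j : K) • FormalComb.pure K (t j), fun x => ?_, ?_⟩
  · rw [FormalComb.sum_apply]
    exact I.asRightIdeal.sum_mem fun j _ => FormalComb.mul_mem_right (hs.1 j) _
  · calc D.lift g (∑ j, (s j : K) • FormalComb.pure K (t j))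
        = ∑ j, (s j : K) • g (t j) := by simp only [map_sum, map_smul, lift_pure]
      _ = g (∑ j, (s j : K) • t j) := by
        rw [map_sum]
        exact Finset.sum_congr rfl fun j _ => (g.map_smul (s j) (t j)).symm
      _ = g r := by rw [← ht, map_sub, hgp, sub_zero]

variable (hS : Dense (S : Set K)) {B : Set (TwoSidedIdeal K)}
  (hbase : (𝓝 (0 : K)).HasCountableBasis (fun I : TwoSidedIdeal K => I ∈ B)
    (fun I => (I : Set K)))
  (hopen : ∀ I ∈ B, IsOpen (I : Set K))
  (hgen : ∀ I ∈ B, ∃ (m : ℕ) (s : Fin m → S),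
    StronglyGenerates I.asRightIdeal fun j => (s j : K))

include hS hbase hopen hgen

theorem linearMap_eq_zero_of_forall_pure {X : Type*} {g : FormalComb K X →ₗ[S] D.Carrier}
    (hg : ∀ x, g (FormalComb.pure K x) = 0) : g = 0 := by
  have := hbase.isCountablyGenerated
  obtain ⟨I, hIB, hI⟩ := hbase.toHasBasis.exists_antitone_subbasis
  refine LinearMap.ext fun r => D.eq_zero_of_forall_exists_lift_eq g
    (fun n => hopen _ (hIB n)) hI.tendsto_smallSets (fun n r => ?_) r
  obtain ⟨m, s, hs⟩ := hgen _ (hIB n)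
  exact exists_lift_eq_of_stronglyGenerates hS (hopen _ (hIB n)) hs hg r

theorem linearMap_contraaction {C : Contramodule.{u, v} K} (f : C.Carrier →ₗ[S] D.Carrier)
    (r : FormalComb K C.Carrier) : f (C.contraaction r) = D.contraaction (FormalComb.map f r) := by
  let g : FormalComb K C.Carrier →ₗ[S] D.Carrier :=
    f ∘ₗ (C.lift id).restrictScalars S - (D.lift f).restrictScalars S
  have hg : g = 0 := linearMap_eq_zero_of_forall_pure hS hbase hopen hgen fun c => by
    simp [g, lift_pure]
  rw [← lift_id_apply, ← lift_apply]
  exact sub_eq_zero.1 (LinearMap.congr_fun hg r)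

end DenseSubring

/-- The morphism of contramodules whose underlying map is a given map commuting with infinite
sums. -/
def homMk {C D : Contramodule.{u, v} K} (f : C.Carrier → D.Carrier)
    (hf : ∀ r, f (C.contraaction r) = D.contraaction (FormalComb.map f r)) : C ⟶ D where
  f := ↾(f : C.A → D.A)
  h := ConcreteCategory.hom_ext _ _ fun r => (hf r).symm

instance forgetful_faithful {R : Type w} [Ring R] (θ : R →+* K) :
    (forgetful.{u, v, w} θ).Faithful where
  map_injective {C D f f'} h := by
    ext c
    exact congrArg (fun φ => φ.hom c) h

end Contramodule

theorem mainTheorem4 {K : Type u} [Ring K] [UniformSpace K] [IsUniformAddGroup K]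
    [IsTopologicalRing K] [CompleteSpace K] [T2Space K] [IsLinearTopology Kᵐᵒᵖ K]
    {R : Type w} [Ring R] (θ : R →+* K) (hθ : DenseRange θ)
    (B : Set (TwoSidedIdeal K)) (hcount : B.Countable)
    (hopen : ∀ I ∈ B, IsOpen (I : Set K))
    (hbase : (𝓝 (0 : K)).HasBasis (fun I : TwoSidedIdeal K => I ∈ B) (fun I => (I : Set K)))
    (hgen : ∀ I ∈ B, ∃ (m : ℕ) (s : Fin m → R),
      StronglyGenerates I.asRightIdeal (fun j => θ (s j))) :
    (Contramodule.forgetful.{u, v, w} θ).Full ∧ (Contramodule.forgetful.{u, v, w} θ).Faithful := by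
  refine ⟨⟨fun {C D} F => ?_⟩, inferInstance⟩
  let f : C.Carrier →ₗ[θ.range] D.Carrier :=
    { toFun := fun c => F.hom c
      map_add' := F.hom.map_add
      map_smul' := by
        rintro ⟨_, a, rfl⟩ c
        exact F.hom.map_smul a c }
  have hdense : Dense (θ.range : Set K) := by rwa [RingHom.coe_range]
  have hgen' : ∀ I ∈ B, ∃ (m : ℕ) (s : Fin m → θ.range),
      StronglyGenerates I.asRightIdeal fun j => (s j : K) := fun I hI =>
    let ⟨m, s, hs⟩ := hgen I hI
    ⟨m, fun j => θ.rangeRestrict (s j), hs⟩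
  refine ⟨Contramodule.homMk f fun r =>
    Contramodule.linearMap_contraaction hdense ⟨hbase, hcount⟩ hopen hgen' f r, ?_⟩
  ext c
  rfl
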